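/- Let $c(G)$ denote the cop number of a finite graph $G$: the least number of cops that can guarantee to capture the robber after finitely many moves, where first the cops and then the robber choose starting vertices, the two sides then alternate starting with the cops, and in its side's turn each piece moves to a neighbouring vertex or stays. A $(d,g)$-cage is a $d$-regular finite graph of girth $g$ with the least number of vertices among all such graphs. Fix an integer $t \ge 1$. If $G$ is a $(p^k, 4t+3)$-cage, where $p$ is an odd prime, $\delta = p^k$ is its minimum degree and $g = 4t+3$ its girth, then $$c(G) = o\big(p^{2tk}\big) = o\big(\delta^{(1-o(1))\frac g2}\big) \qquad \text{as } k \to \infty,$$ uniformly in $p$. That is, for every real sequence $\eta_k \to 0$ and every $\varepsilon > 0$ there is a $K$ (depending only on $t$, $\varepsilon$ and the sequence) such that for all $k \ge K$, all odd primes $p$ and all $(p^k,4t+3)$-cages $G$, $$c(G) \le \varepsilon\, p^{2tk}, \qquad p^{2tk} \le \delta^{(1-\eta_k)\frac g2} \qquad\text{and}\qquad c(G) \le \varepsilon\, \delta^{(1-\eta_k)\frac g2}.$$ -/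

import Mathlib

open Filter Topology

namespace SimpleGraph

/-- One move of a single piece: from `v` to a vertex of the closed neighbourhood of `v`. -/
def IsMove {V : Type*} (G : SimpleGraph V) (v w : V) : Prop :=
  w = v ∨ G.Adj v w

/-- `G.CopsWinFrom c r`: with the cops on the vertices `c i` and the robber on `r`, the cops being
the next to move, the cops can force a capture after finitely many moves (the least fixed point of
the rules of the game).

* `capture`: a cop stands on the vertex of the robber.
* `move`: the cops have a joint move to positions `c'` such that either some cop lands on the
  vertex `r` of the robber (the last premise is then void), or the cops win after every reply
  `r'` of the robber. -/
inductive CopsWinFrom {V : Type*} (G : SimpleGraph V) {m : ℕ} : (Fin m → V) → V → Prop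
  | capture (c : Fin m → V) (r : V) (i : Fin m) (h : c i = r) : CopsWinFrom G c r
  | move (c c' : Fin m → V) (r : V) (hc : ∀ i, G.IsMove (c i) (c' i))
      (h : (∀ i, c' i ≠ r) → ∀ r', G.IsMove r r' → CopsWinFrom G c' r') : CopsWinFrom G c r

/-- `m` cops win on `G`: they have starting positions from which they win wherever the robber
starts; the cops make the first move. -/
def CopsWin {V : Type*} (G : SimpleGraph V) (m : ℕ) : Prop :=
  ∃ c : Fin m → V, ∀ r : V, G.CopsWinFrom c r

/-- On a finite graph, one cop on each vertex wins, so the cop number below is a minimum over a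
nonempty set. -/
theorem copsWin_card {V : Type*} [Fintype V] (G : SimpleGraph V) :
    G.CopsWin (Fintype.card V) :=
  ⟨(Fintype.equivFin V).symm, fun r => .capture _ r (Fintype.equivFin V r) (by simp)⟩

/-- The cop number of a (finite) graph: the least number of cops that win. -/
noncomputable def copNumber {V : Type*} (G : SimpleGraph V) : ℕ :=
  sInf {m : ℕ | G.CopsWin m}

/-- A `(d, g)`-cage: a finite `d`-regular graph of girth (exactly) `g`, of minimal order among all
such graphs. -/
structure IsCage {V : Type*} [Fintype V] (G : SimpleGraph V) [DecidableRel G.Adj] (d g : ℕ) :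
    Prop where
  regular : G.IsRegularOfDegree d
  egirth_eq : G.egirth = (g : ℕ∞)
  card_le : ∀ (m : ℕ) (H : SimpleGraph (Fin m)) [DecidableRel H.Adj],
    H.IsRegularOfDegree d → H.egirth = (g : ℕ∞) → Fintype.card V ≤ m

end SimpleGraph

/-! Write q = p^k and let n be the order of the cage. Girth 4t+3 makes geodesics of length at most
2t+1 unique, so a vertex within distance t of the robber has at least (q-1)^(t+1) vertices exactly
t+1 steps beyond it, its cone. If every cone contains a cop, then t+1 copies of these cops can
occupy the whole radius-t ball around the robber in t+1 moves, while the robber makes only t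
(`copsWin_of_hits_cones`). There are at most n^2 cones, so by a union bound slightly more than 2 n
log n / (q-1)^(t+1) random vertices meet them all (`copNumber_le`).

With n ≤ 2 q^(3t) this gives O(q^(2t-1) log q) cops, which is o(q^(2t)) with constants depending
only on t, hence uniformly in p. The bound on n needs a small q-regular graph. A coset graph of a
group of matrices over F[X]/(X^(t+1)) has girth at least 4t+4 (`exists_regular_large_girth`); its
girth is then brought down to exactly 4t+3 by a surgery that removes vertices, keeps the degree, and
needs q odd (`exists_regular_egirth_eq`). -/

namespace SimpleGraph

/-! ### Cones in graphs of large girth, and the cops' strategy -/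

section Cops

variable {V : Type*} {G : SimpleGraph V}

/-- The edges of the two paths together are too few to contain a cycle, so they span a forest, where
paths are unique. -/
theorem Walk.IsPath.eq_of_length_add_length_lt_egirth {a b : V} {p q : G.Walk a b}
    (hp : p.IsPath) (hq : q.IsPath) (h : ((p.length + q.length : ℕ) : ℕ∞) < G.egirth) : p = q := by
  classical
  set H : SimpleGraph V := fromEdgeSet {e | e ∈ p.edges ∨ e ∈ q.edges}
  have hpH : ∀ e ∈ p.edges, e ∈ H.edgeSet := fun e he => by
    rw [edgeSet_fromEdgeSet]
    exact ⟨Or.inl he, G.not_isDiag_of_mem_edgeSet (p.edges_subset_edgeSet he)⟩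
  have hqH : ∀ e ∈ q.edges, e ∈ H.edgeSet := fun e he => by
    rw [edgeSet_fromEdgeSet]
    exact ⟨Or.inr he, G.not_isDiag_of_mem_edgeSet (q.edges_subset_edgeSet he)⟩
  have hmem : ∀ e ∈ H.edgeSet, e ∈ p.edges ∨ e ∈ q.edges := fun e he => by
    rw [edgeSet_fromEdgeSet] at he
    exact he.1
  have hHG : H ≤ G := by
    rw [← edgeSet_subset_edgeSet]
    intro e he
    exact (hmem e he).elim (fun h => p.edges_subset_edgeSet h) (fun h => q.edges_subset_edgeSet h)
  have hac : H.IsAcyclic := by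
    intro x c hc
    have h1 : c.length ≤ p.length + q.length := by
      rw [← c.length_edges, ← List.toFinset_card_of_nodup hc.edges_nodup, ← p.length_edges,
        ← q.length_edges, ← List.length_append]
      refine (Finset.card_le_card ?_).trans (List.toFinset_card_le _)
      intro e he
      rw [List.mem_toFinset] at he ⊢
      rw [List.mem_append]
      exact hmem e (c.edges_subset_edgeSet he)
    have h2 := egirth_le_length (hc.mapLe hHG)
    rw [Walk.length_map] at h2
    exact absurd (h2.trans (Nat.cast_le.mpr h1)) (not_le.mpr h)
  have := (hac.subsingleton_path a b).elim ⟨p.transfer H hpH, hp.transfer hpH⟩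
    ⟨q.transfer H hqH, hq.transfer hqH⟩
  rw [Subtype.mk.injEq] at this
  have h3 := congrArg Walk.support this
  rw [Walk.support_transfer, Walk.support_transfer] at h3
  exact Walk.ext_support h3

/-- In a graph of large girth, at most one neighbour of `w` is no further from `v` than `w`. -/
theorem eq_of_adj_of_dist_le {g : ℕ} (hg : (g : ℕ∞) ≤ G.egirth) {v w z z' : V}
    (hz : G.Adj w z) (hz' : G.Adj w z') (hv : G.Reachable v w)
    (hd : G.dist v z ≤ G.dist v w) (hd' : G.dist v z' ≤ G.dist v w)
    (hlt : G.dist v z + G.dist v z' + 2 < g) : z = z' := by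
  obtain ⟨p, hp, hpl⟩ := (hv.trans hz.reachable).exists_path_of_dist
  obtain ⟨p', hp', hpl'⟩ := (hv.trans hz'.reachable).exists_path_of_dist
  -- A geodesic to `y` avoids `w`, so it extends to a path ending at `w`; the two extensions must
  -- coincide.
  have key : ∀ {y : V} (r : G.Walk v y), G.Adj w y → r.length = G.dist v y →
      G.dist v y ≤ G.dist v w → w ∉ r.support := by
    intro y r hy hr hle hw
    classical
    have h1 := congrArg Walk.length (r.take_spec hw)
    rw [Walk.length_append] at h1
    have h2 := dist_le (r.takeUntil w hw)
    have h3 : (r.dropUntil w hw).length ≠ 0 := fun h0 => hy.ne (Walk.eq_of_length_eq_zero h0)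
    omega
  have e := Walk.IsPath.eq_of_length_add_length_lt_egirth
    (hp.concat (key p hz hpl hd) hz.symm) (hp'.concat (key p' hz' hpl' hd') hz'.symm) (by
      rw [Walk.length_concat, Walk.length_concat]
      refine lt_of_lt_of_le ?_ hg
      rw [Nat.cast_lt]
      omega)
  have := congrArg Walk.penultimate e
  simpa using this

/-- The vertices at distance `k` from `u` that lie beyond `u` as seen from `v`. -/
noncomputable def cone [Fintype V] (G : SimpleGraph V) (v u : V) (k : ℕ) : Finset V :=
  open Classical in
  -- Reachability is required because `dist` is 0 between different components.
  Finset.univ.filter fun w => G.dist v w = G.dist v u + k ∧ G.Reachable u w ∧ G.dist u w ≤ k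

theorem mem_cone [Fintype V] {v u w : V} {k : ℕ} :
    w ∈ G.cone v u k ↔ G.dist v w = G.dist v u + k ∧ G.Reachable u w ∧ G.dist u w ≤ k := by
  simp [cone]

/-- By `eq_of_adj_of_dist_le`, each vertex has at least d-1 neighbours further from `v`, and no two
vertices of one level share such a neighbour, so each level is at least d-1 times the previous one.
-/
theorem pow_le_card_cone [Fintype V] {d r : ℕ}
    (hreg : ∀ x, (G.neighborSet x).ncard = d) (hg : ((2 * r + 1 : ℕ) : ℕ∞) ≤ G.egirth)
    {v u : V} (hu : G.Reachable v u) (k : ℕ) (hk : G.dist v u + k ≤ r) :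
    (d - 1) ^ k ≤ (G.cone v u k).card := by
  classical
  induction k with
  | zero =>
    rw [pow_zero, Nat.one_le_iff_ne_zero, Finset.card_ne_zero]
    exact ⟨u, mem_cone.mpr ⟨rfl, Reachable.refl _, by simp⟩⟩
  | succ k ih =>
    have ih := ih (by omega)
    let N : V → Finset V := fun w => (G.neighborSet w).toFinset.filter
      fun z => G.dist v w < G.dist v z
    have hN : ∀ w ∈ G.cone v u k, d - 1 ≤ (N w).card := by
      intro w hw
      obtain ⟨h1, h2, -⟩ := mem_cone.mp hw
      have hc : (G.neighborSet w).toFinset.card = d := by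
        rw [← Set.ncard_eq_toFinset_card', hreg]
      rw [← Finset.card_filter_add_card_filter_not
        (fun z => G.dist v w < G.dist v z)] at hc
      have : ((G.neighborSet w).toFinset.filter
          fun z => ¬ G.dist v w < G.dist v z).card ≤ 1 := by
        rw [Finset.card_le_one]
        intro z hz z' hz'
        simp only [Finset.mem_filter, Set.mem_toFinset, mem_neighborSet, not_lt] at hz hz'
        exact eq_of_adj_of_dist_le hg hz.1 hz'.1 (hu.trans h2) hz.2 hz'.2 (by omega)
      have h3 : (N w).card = ((G.neighborSet w).toFinset.filter
          fun z => G.dist v w < G.dist v z).card := rfl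
      omega
    have hdist : ∀ w ∈ G.cone v u k, ∀ z ∈ N w, G.Adj w z ∧ G.dist v z = G.dist v u + (k + 1) := by
      intro w hw z hz
      obtain ⟨h1, h2, -⟩ := mem_cone.mp hw
      simp only [N, Finset.mem_filter, Set.mem_toFinset, mem_neighborSet] at hz
      have h4 := (hu.trans h2).dist_triangle_left z
      rw [dist_eq_one_iff_adj.mpr hz.1] at h4
      exact ⟨hz.1, by omega⟩
    have hdisj : (G.cone v u k : Set V).PairwiseDisjoint N := by
      intro w hw w' hw' hne
      rw [Function.onFun, Finset.disjoint_left]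
      intro z hz hz'
      obtain ⟨a, b⟩ := hdist w hw z hz
      obtain ⟨a', b'⟩ := hdist w' hw' z hz'
      obtain ⟨c, c1, -⟩ := mem_cone.mp hw
      obtain ⟨c', -⟩ := mem_cone.mp hw'
      exact hne (eq_of_adj_of_dist_le hg a.symm a'.symm ((hu.trans c1).trans a.reachable)
        (by omega) (by omega) (by omega))
    have hsub : (G.cone v u k).biUnion N ⊆ G.cone v u (k + 1) := by
      intro z hz
      obtain ⟨w, hw, hz⟩ := Finset.mem_biUnion.mp hz
      obtain ⟨a, b⟩ := hdist w hw z hz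
      obtain ⟨-, h2, h3⟩ := mem_cone.mp hw
      refine mem_cone.mpr ⟨b, h2.trans a.reachable, ?_⟩
      have h4 := h2.dist_triangle_left z
      rw [dist_eq_one_iff_adj.mpr a] at h4
      omega
    calc (d - 1) ^ (k + 1) = (d - 1) ^ k * (d - 1) := pow_succ _ _
      _ ≤ (G.cone v u k).card * (d - 1) := Nat.mul_le_mul_right _ ih
      _ ≤ ∑ w ∈ G.cone v u k, (N w).card := by
        rw [← smul_eq_mul]
        exact Finset.card_nsmul_le_sum _ _ _ hN
      _ = ((G.cone v u k).biUnion N).card := (Finset.card_biUnion hdisj).symm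
      _ ≤ _ := Finset.card_le_card hsub

/-- In a graph of large girth, the cones at two vertices equidistant from `v` are disjoint. -/
theorem eq_of_mem_cone [Fintype V] {r k : ℕ} (hg : ((2 * r + 1 : ℕ) : ℕ∞) ≤ G.egirth)
    {v u u' w : V} (hu : G.Reachable v u) (hu' : G.Reachable v u')
    (hd : G.dist v u = G.dist v u') (hk : G.dist v u + k ≤ r)
    (hw : w ∈ G.cone v u k) (hw' : w ∈ G.cone v u' k) : u = u' := by
  obtain ⟨h1, h2, h3⟩ := mem_cone.mp hw
  obtain ⟨h1', h2', h3'⟩ := mem_cone.mp hw'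
  obtain ⟨p, hp⟩ := hu.exists_walk_length_eq_dist
  obtain ⟨p', hp'⟩ := hu'.exists_walk_length_eq_dist
  obtain ⟨s, hs⟩ := h2.exists_walk_length_eq_dist
  obtain ⟨s', hs'⟩ := h2'.exists_walk_length_eq_dist
  have a := dist_le (p.append s)
  have a' := dist_le (p'.append s')
  rw [Walk.length_append] at a a'
  have e := Walk.IsPath.eq_of_length_add_length_lt_egirth
    ((p.append s).isPath_of_length_eq_dist (by rw [Walk.length_append]; omega))
    ((p'.append s').isPath_of_length_eq_dist (by rw [Walk.length_append]; omega)) (by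
      refine lt_of_lt_of_le ?_ hg
      rw [Nat.cast_lt, Walk.length_append, Walk.length_append]
      omega)
  have e1 := congrArg (fun x : G.Walk v w => x.getVert (G.dist v u)) e
  simp only [Walk.getVert_append] at e1
  rw [if_neg (by omega), if_neg (by omega), hp, hp', hd, Nat.sub_self] at e1
  simpa using e1

/-- The cops walk to fixed targets covering the ball of radius `T` about the robber. They move
first, so they have `T + 1` moves against the robber's `T`. -/
theorem copsWinFrom_of_targets {m : ℕ} (T : ℕ) (c τ : Fin m → V) (r : V)
    (hτ : ∀ i, ∃ w : G.Walk (c i) (τ i), w.length ≤ T + 1)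
    (h : ∀ u, ∀ w : G.Walk r u, w.length ≤ T → ∃ i, τ i = u) : G.CopsWinFrom c r := by
  induction T generalizing c r with
  | zero =>
    obtain ⟨i, hi⟩ := h r .nil le_rfl
    refine .move c τ r (fun j => ?_) fun hne => absurd hi (hne i)
    have hj := hτ j
    generalize τ j = x at hj ⊢
    obtain ⟨w, hw⟩ := hj
    cases w with
    | nil => exact Or.inl rfl
    | cons ha p =>
      rw [Walk.length_cons] at hw
      have := Walk.eq_of_length_eq_zero (p := p) (by omega)
      exact Or.inr (this ▸ ha)
  | succ T ih =>
    have step : ∀ j, ∃ x, G.IsMove (c j) x ∧ ∃ w : G.Walk x (τ j), w.length ≤ T + 1 := by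
      intro j
      obtain ⟨w, hw⟩ := hτ j
      generalize hx : τ j = x at w
      cases w with
      | nil => exact ⟨c j, Or.inl rfl, Walk.nil, by simp⟩
      | cons ha p =>
        rw [Walk.length_cons] at hw
        exact ⟨_, Or.inr ha, p, by omega⟩
    choose c' hc' hw' using step
    refine .move c c' r hc' fun _ r' hr' => ih c' r' hw' fun u w hw => ?_
    rcases hr' with rfl | hr'
    · exact h u w (by omega)
    · exact h u (w.cons hr') (by rw [Walk.length_cons]; omega)

theorem copsWin_of_hits_cones [Fintype V] {t m : ℕ} (hg : ((4 * t + 3 : ℕ) : ℕ∞) ≤ G.egirth)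
    (c : Fin m → V)
    (hc : ∀ v u, G.Reachable v u → G.dist v u ≤ t → ∃ i, c i ∈ G.cone v u (t + 1)) :
    G.CopsWin ((t + 1) * m) := by
  classical
  have hg' : ((2 * (2 * t + 1) + 1 : ℕ) : ℕ∞) ≤ G.egirth := by
    convert hg using 2
    ring
  refine ⟨fun i => c (finProdFinEquiv.symm i).2, fun r => ?_⟩
  -- Copy `j.1` of the cops serves the sphere of radius `j.1` about the robber. Cones from one
  -- sphere are disjoint, so each cop gets at most one target; cones from different spheres may
  -- overlap, hence the `t + 1` copies.
  let Q : Fin (t + 1) × Fin m → V → Prop := fun j u =>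
    G.Reachable r u ∧ G.dist r u = j.1 ∧ c j.2 ∈ G.cone r u (t + 1)
  let τ : Fin (t + 1) × Fin m → V := fun j => if h : ∃ u, Q j u then h.choose else c j.2
  refine copsWinFrom_of_targets t _ (fun i => τ (finProdFinEquiv.symm i)) r (fun i => ?_) ?_
  · generalize finProdFinEquiv.symm i = j
    by_cases h : ∃ u, Q j u
    · have e : τ j = h.choose := dif_pos h
      obtain ⟨-, -, h3⟩ := h.choose_spec
      obtain ⟨-, h4, h5⟩ := mem_cone.mp h3
      obtain ⟨w, hw⟩ := h4.exists_walk_length_eq_dist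
      rw [e]
      exact ⟨w.reverse, by rw [Walk.length_reverse]; omega⟩
    · have e : τ j = c j.2 := dif_neg h
      rw [e]
      exact ⟨.nil, by simp⟩
  · intro u w hw
    have hd : G.dist r u ≤ t := (dist_le w).trans hw
    obtain ⟨i, hi⟩ := hc r u w.reachable hd
    let j : Fin (t + 1) × Fin m := (⟨G.dist r u, by omega⟩, i)
    have hQ : Q j u := ⟨w.reachable, rfl, hi⟩
    have hex : ∃ u, Q j u := ⟨u, hQ⟩
    refine ⟨finProdFinEquiv j, ?_⟩
    have e : τ j = hex.choose := dif_pos hex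
    rw [Equiv.symm_apply_apply, e]
    obtain ⟨h1, h2, h3⟩ := hex.choose_spec
    have h2' : G.dist r hex.choose = G.dist r u := h2
    exact eq_of_mem_cone hg' h1 w.reachable h2' (by omega) h3 hi

end Cops

end SimpleGraph

/-! ### Random placement of the cops, by counting tuples -/

theorem exists_hitting_tuple {V ι : Type*} [Fintype V] [Fintype ι] (S : ι → Finset V) {s m : ℕ}
    (hS : ∀ i, s ≤ (S i).card)
    (h : Fintype.card ι * (Fintype.card V - s) ^ m < Fintype.card V ^ m) :
    ∃ c : Fin m → V, ∀ i, ∃ j, c j ∈ S i := by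
  classical
  by_contra! hcon
  have hsub : (Finset.univ : Finset (Fin m → V)) ⊆
      Finset.univ.biUnion fun i => Fintype.piFinset fun _ => (S i)ᶜ := by
    intro c _
    obtain ⟨i, hi⟩ := hcon c
    simpa using ⟨i, hi⟩
  have h1 := (Finset.card_le_card hsub).trans Finset.card_biUnion_le
  have h2 : ∑ i : ι, (Fintype.piFinset fun _ : Fin m => (S i)ᶜ).card ≤
      Fintype.card ι * (Fintype.card V - s) ^ m := by
    rw [← Finset.card_univ, ← smul_eq_mul]
    refine Finset.sum_le_card_nsmul _ _ _ fun i _ => ?_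
    rw [Fintype.card_piFinset_const, Finset.card_compl]
    exact Nat.pow_le_pow_left (Nat.sub_le_sub_left (hS i) _) _
  rw [Finset.card_univ, Fintype.card_pi_const] at h1
  omega

theorem SimpleGraph.copNumber_le {V : Type*} [Fintype V] {G : SimpleGraph V} {d t m : ℕ}
    (hreg : ∀ x, (G.neighborSet x).ncard = d) (hg : ((4 * t + 3 : ℕ) : ℕ∞) ≤ G.egirth)
    (h : Fintype.card V ^ 2 * (Fintype.card V - (d - 1) ^ (t + 1)) ^ m < Fintype.card V ^ m) :
    G.copNumber ≤ (t + 1) * m := by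
  classical
  -- One cone per pair (robber, target): the source of the factor n^2.
  have hcard : Fintype.card {x : V × V // G.Reachable x.1 x.2 ∧ G.dist x.1 x.2 ≤ t} ≤
      Fintype.card V ^ 2 := by
    rw [sq, ← Fintype.card_prod]
    exact Fintype.card_subtype_le _
  obtain ⟨c, hc⟩ := exists_hitting_tuple
    (fun x : {x : V × V // G.Reachable x.1 x.2 ∧ G.dist x.1 x.2 ≤ t} =>
      G.cone x.1.1 x.1.2 (t + 1))
    (fun x => pow_le_card_cone (r := 2 * t + 1) hreg (by convert hg using 2; ring) x.2.1 _
      (by have := x.2.2; omega)) (m := m) (lt_of_le_of_lt (Nat.mul_le_mul_right _ hcard) h)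
  exact Nat.sInf_le (copsWin_of_hits_cones hg c fun v u h1 h2 => hc ⟨(v, u), h1, h2⟩)

namespace SimpleGraph

/-! ### Lowering the girth by deleting edges' endpoints -/

section Surgery

variable {V : Type*} {G : SimpleGraph V}

/-- A periodic parametrisation lets later arguments start the cycle anywhere without rotating walks.
-/
theorem Walk.IsCycle.exists_periodic {a : V} {c : G.Walk a a} (hc : c.IsCycle) :
    ∃ f : ℕ → V, (∀ i, G.Adj (f i) (f (i + 1))) ∧
      ∀ i j, f i = f j ↔ i ≡ j [MOD c.length] := by
  have h3 := hc.three_le_length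
  have hlt : ∀ i, i % c.length < c.length := fun i => Nat.mod_lt _ (by omega)
  refine ⟨fun i => c.getVert (i % c.length), fun i => ?_, fun i j => ⟨fun h => ?_, fun h => ?_⟩⟩
  · have h1 := c.adj_getVert_succ (hlt i)
    have h2 : c.getVert ((i + 1) % c.length) = c.getVert (i % c.length + 1) := by
      rw [Nat.add_mod, Nat.mod_eq_of_lt (show 1 < c.length by omega)]
      rcases Nat.lt_or_ge (i % c.length + 1) c.length with h | h
      · rw [Nat.mod_eq_of_lt h]
      · have : i % c.length + 1 = c.length := le_antisymm (hlt i) h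
        rw [this, Nat.mod_self, c.getVert_zero, c.getVert_length]
    change G.Adj _ (c.getVert ((i + 1) % c.length))
    rwa [h2]
  · exact hc.getVert_injOn' (by have := hlt i; simp only [Set.mem_ofPred_eq]; omega)
      (by have := hlt j; simp only [Set.mem_ofPred_eq]; omega) h
  · exact congrArg c.getVert h

theorem exists_walk_of_adj_succ (f : ℕ → V) (i n : ℕ)
    (h : ∀ j < n, G.Adj (f (i + j)) (f (i + j + 1))) :
    ∃ w : G.Walk (f i) (f (i + n)), w.length = n ∧ ∀ x ∈ w.support, ∃ j ≤ n, x = f (i + j) := by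
  induction n with
  | zero => exact ⟨.nil, rfl, fun x hx => ⟨0, le_rfl, by simpa using hx⟩⟩
  | succ n ih =>
    obtain ⟨w, hl, hs⟩ := ih fun j hj => h j (by omega)
    refine ⟨w.concat (h n (by omega)), by rw [Walk.length_concat, hl], fun x hx => ?_⟩
    rw [Walk.support_concat, List.mem_append, List.mem_singleton] at hx
    rcases hx with hx | rfl
    · obtain ⟨j, hj, rfl⟩ := hs x hx
      exact ⟨j, by omega, rfl⟩
    · exact ⟨n + 1, le_rfl, rfl⟩

/-- A walk between two neighbours of `u` that avoids `u` closes up to a cycle through `u`. -/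
theorem egirth_le_of_walk_avoiding {u x y : V} (hx : G.Adj u x) (hy : G.Adj u y) (hne : x ≠ y)
    (w : G.Walk x y) (hu : u ∉ w.support) : G.egirth ≤ ((w.length + 2 : ℕ) : ℕ∞) := by
  classical
  have hb : u ∉ w.bypass.support := fun h => hu (w.support_bypass_subset_support h)
  have hc : (Walk.cons hx (w.bypass.concat hy.symm)).IsCycle := by
    rw [Walk.cons_isCycle_iff]
    refine ⟨w.bypass_isPath.concat hb _, ?_⟩
    rw [Walk.edges_concat, List.concat_eq_append, List.mem_append, List.mem_singleton, not_or]
    refine ⟨fun h => hb (Walk.fst_mem_support_of_mem_edges _ h), fun h => ?_⟩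
    rw [Sym2.eq_swap, Sym2.eq_iff] at h
    rcases h with ⟨h, -⟩ | ⟨-, h⟩
    · exact hne h
    · exact hy.ne h
  refine (egirth_le_length hc).trans ?_
  rw [Walk.length_cons, Walk.length_concat, Nat.cast_le]
  have := w.length_bypass_le_length
  omega

theorem exists_pairing {α : Type*} (S : Finset α) (hS : Even S.card) :
    ∃ σ : α → α, ∀ x ∈ S, σ x ∈ S ∧ σ x ≠ x ∧ σ (σ x) = x := by
  classical
  obtain ⟨m, hm⟩ := hS
  have e : S ≃ Fin m × Bool := Fintype.equivOfCardEq (by simp [hm, mul_two])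
  let ρ : S → S := fun x => e.symm ((e x).1, !(e x).2)
  refine ⟨fun x => if h : x ∈ S then ρ ⟨x, h⟩ else x, fun x hx => ?_⟩
  have h1 : ρ ⟨x, hx⟩ ≠ ⟨x, hx⟩ := fun h => by
    have := congrArg (fun y => (e y).2) h
    simp [ρ] at this
  have h2 : ρ (ρ ⟨x, hx⟩) = ⟨x, hx⟩ := by simp [ρ]
  have h3 : (ρ ⟨x, hx⟩ : α) ∈ S := (ρ ⟨x, hx⟩).2
  simp only [dif_pos hx, dif_pos h3, Subtype.coe_eta, h2]
  exact ⟨h3, fun h => h1 (Subtype.ext h), trivial⟩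

/-- `σ` pairs up the vertices adjacent to `u`, and those adjacent to `v`, other than `u`, `v`. -/
def IsPairing (G : SimpleGraph V) (u v : V) (σ : V → V) : Prop :=
  (∀ x, x ≠ v → G.Adj u x → σ x ≠ v ∧ G.Adj u (σ x) ∧ σ x ≠ x ∧ σ (σ x) = x) ∧
    ∀ x, x ≠ u → G.Adj v x → σ x ≠ u ∧ G.Adj v (σ x) ∧ σ x ≠ x ∧ σ (σ x) = x

/-- Delete the vertices `u`, `v` and join their former neighbours in pairs. -/
def deletePair (G : SimpleGraph V) {u v : V} {σ : V → V} (hσ : G.IsPairing u v σ) :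
    SimpleGraph {x : V // x ≠ u ∧ x ≠ v} where
  Adj x y := G.Adj x y ∨ ((G.Adj u x ∨ G.Adj v x) ∧ (y : V) = σ x)
  symm := ⟨by
    rintro ⟨x, hx⟩ ⟨y, hy⟩ (h | ⟨h | h, e⟩)
    · exact Or.inl h.symm
    · obtain ⟨-, h2, -, h4⟩ := hσ.1 x hx.2 h
      dsimp only at e ⊢
      subst e
      exact Or.inr ⟨Or.inl h2, h4.symm⟩
    · obtain ⟨-, h2, -, h4⟩ := hσ.2 x hx.1 h
      dsimp only at e ⊢
      subst e
      exact Or.inr ⟨Or.inr h2, h4.symm⟩⟩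
  loopless := ⟨by
    rintro ⟨x, hx⟩ (h | ⟨h | h, e⟩)
    · exact G.loopless.irrefl _ h
    · exact (hσ.1 x hx.2 h).2.2.1 e.symm
    · exact (hσ.2 x hx.1 h).2.2.1 e.symm⟩

theorem not_adj_of_four_le_egirth (hg : 4 ≤ G.egirth) {x y z : V} (hxy : G.Adj x y)
    (hxz : G.Adj x z) : ¬ G.Adj y z := by
  intro h
  have := egirth_le_of_walk_avoiding hxy hxz h.ne (.cons h .nil)
    (by simp [hxy.ne, hxz.ne])
  have h2 := hg.trans this
  simp only [Walk.length_cons, Walk.length_nil] at h2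
  exact absurd h2 (by decide)

/-- Each endpoint has d-1 other neighbours, an even number. Without triangles the two neighbourhoods
are disjoint, so one map can pair both. -/
theorem exists_isPairing [Fintype V] {d : ℕ} (hd : Odd d)
    (hreg : ∀ x, (G.neighborSet x).ncard = d) (hg : 4 ≤ G.egirth) {u v : V} (huv : G.Adj u v) :
    ∃ σ, G.IsPairing u v σ := by
  classical
  have key : ∀ a b, G.Adj a b → ∃ σ : V → V, ∀ x, x ≠ b → G.Adj a x →
      σ x ≠ b ∧ G.Adj a (σ x) ∧ σ x ≠ x ∧ σ (σ x) = x := by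
    intro a b hab
    have hcard : ((G.neighborSet a).toFinset.erase b).card = d - 1 := by
      rw [Finset.card_erase_of_mem (by simpa using hab), ← Set.ncard_eq_toFinset_card', hreg]
    obtain ⟨σ, hσ⟩ := exists_pairing ((G.neighborSet a).toFinset.erase b) (by
      rw [hcard]
      exact Nat.Odd.sub_odd hd odd_one)
    refine ⟨σ, fun x hx hax => ?_⟩
    have := hσ x (by simp [hx, hax])
    simpa [and_assoc] using this
  obtain ⟨ρ, hρ⟩ := key u v huv
  obtain ⟨τ, hτ⟩ := key v u huv.symm
  refine ⟨fun x => if G.Adj u x then ρ x else τ x, fun x hx hux => ?_, fun x hx hvx => ?_⟩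
  · have := hρ x hx hux
    simp only [if_pos hux, if_pos this.2.1]
    exact this
  · have := hτ x hx hvx
    have h1 : ¬ G.Adj u x := fun h => not_adj_of_four_le_egirth hg huv h hvx
    have h2 : ¬ G.Adj u (τ x) := fun h => not_adj_of_four_le_egirth hg huv h this.2.1
    simp only [if_neg h1, if_neg h2]
    exact this

/-- Without triangles, a vertex loses at most one of `u`, `v`, and the partner it gains in exchange
was not already its neighbour. -/
theorem ncard_neighborSet_deletePair {u v : V} {σ : V → V} (hσ : G.IsPairing u v σ)
    (hg : 4 ≤ G.egirth) (huv : G.Adj u v) (x : {x : V // x ≠ u ∧ x ≠ v}) :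
    ((G.deletePair hσ).neighborSet x).ncard = (G.neighborSet x).ncard := by
  classical
  obtain ⟨x, hxu, hxv⟩ := x
  have hS : G.Adj u x ∨ G.Adj v x → σ x ≠ u ∧ σ x ≠ v ∧ ¬ G.Adj x (σ x) := by
    rintro (h | h)
    · obtain ⟨h1, h2, -⟩ := hσ.1 x hxv h
      exact ⟨h2.ne', h1, not_adj_of_four_le_egirth hg h h2⟩
    · obtain ⟨h1, h2, -⟩ := hσ.2 x hxu h
      exact ⟨h1, h2.ne', not_adj_of_four_le_egirth hg h h2⟩
  let φ : V → V := fun y => if y = u ∨ y = v then σ x else y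
  have hinj : Set.InjOn φ (G.neighborSet x) := by
    have hcase : ∀ y ∈ G.neighborSet x, ∀ z ∈ G.neighborSet x, (y = u ∨ y = v) →
        ¬ (z = u ∨ z = v) → φ y ≠ φ z := by
      intro y hy z hz h h' e
      simp only [φ, if_pos h, if_neg h'] at e
      refine (hS ?_).2.2 (e ▸ hz)
      rcases h with rfl | rfl
      · exact Or.inl hy.symm
      · exact Or.inr hy.symm
    intro y hy z hz e
    by_cases h : y = u ∨ y = v <;> by_cases h' : z = u ∨ z = v
    · have hno := not_adj_of_four_le_egirth hg huv (z := x)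
      rcases h with rfl | rfl <;> rcases h' with rfl | rfl
      · rfl
      · exact absurd hz.symm (hno hy.symm)
      · exact absurd hy.symm (hno hz.symm)
      · rfl
    · exact absurd e (hcase y hy z hz h h')
    · exact absurd e.symm (hcase z hz y hy h' h)
    · simpa only [φ, if_neg h, if_neg h'] using e
  have himg : Subtype.val '' ((G.deletePair hσ).neighborSet ⟨x, hxu, hxv⟩) =
      φ '' G.neighborSet x := by
    ext y
    constructor
    · rintro ⟨⟨y, hyu, hyv⟩, h | ⟨h | h, e⟩, rfl⟩
      · exact ⟨y, h, if_neg (by simp [hyu, hyv])⟩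
      · exact ⟨u, h.symm, by simpa [φ] using e.symm⟩
      · exact ⟨v, h.symm, by simpa [φ] using e.symm⟩
    · rintro ⟨y, hy, rfl⟩
      by_cases h : y = u ∨ y = v
      · have h' : G.Adj u x ∨ G.Adj v x := by
          rcases h with rfl | rfl
          · exact Or.inl hy.symm
          · exact Or.inr hy.symm
        simp only [φ, if_pos h]
        exact ⟨⟨σ x, (hS h').1, (hS h').2.1⟩, Or.inr ⟨h', rfl⟩, rfl⟩
      · simp only [φ, if_neg h]
        rw [not_or] at h
        exact ⟨⟨y, h⟩, Or.inl hy, rfl⟩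
  rw [← Set.ncard_image_of_injective _ Subtype.val_injective, himg, hinj.ncard_image]

/-- An arc of a new cycle between successive new edges lies in `G`, with both ends next to `u` or
`v`. It closes up in `G` through one of these vertices, adding 2 to its length, or through the edge
`u v`, adding 3; the new edges on the cycle make up for all but 1 of this. -/
theorem le_egirth_deletePair {g : ℕ} {u v : V} {σ : V → V} (hσ : G.IsPairing u v σ)
    (hg : ((g + 1 : ℕ) : ℕ∞) ≤ G.egirth) (huv : G.Adj u v) :
    (g : ℕ∞) ≤ (G.deletePair hσ).egirth := by
  rw [le_egirth]
  intro a c hc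
  have h3 := hc.three_le_length
  obtain ⟨f, hadj, hf⟩ := hc.exists_periodic
  set l := c.length
  rw [Nat.cast_le]
  have hval : ∀ {i j}, (f i : V) = f j ↔ i ≡ j [MOD l] := fun {i j} => by
    rw [← hf, Subtype.ext_iff]
  have close : ∀ {z x y : V} (w : G.Walk x y), G.Adj z x → G.Adj z y → x ≠ y → z ∉ w.support →
      g ≤ w.length + 1 := fun w h1 h2 h3 h4 => by
    have := hg.trans (egirth_le_of_walk_avoiding h1 h2 h3 w h4)
    rw [Nat.cast_le] at this
    omega
  have hnmod : ∀ i r, 0 < r → r < l → ¬ i + r ≡ i [MOD l] := fun i r h0 hr h => by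
    have h1 := Nat.ModEq.add_left_cancel' (c := i) (a := r) (b := 0) h
    rw [Nat.ModEq, Nat.zero_mod, Nat.mod_eq_of_lt hr] at h1
    omega
  by_cases hold : ∀ i, G.Adj (f i) (f (i + 1))
  · obtain ⟨w, hw, hs⟩ := exists_walk_of_adj_succ (fun i => (f i : V)) 1 (l - 2)
      fun j _ => hold _
    have hend : (f (l - 1 + 1) : V) = f 0 := hval.mpr (by
      rw [Nat.sub_add_cancel (by omega)]
      simp [Nat.ModEq])
    have hlast := hold (l - 1)
    rw [hend, show l - 1 = 1 + (l - 2) by omega] at hlast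
    have := close w (hold 0) hlast.symm (fun e => by
        have := hval.mp e.symm
        exact hnmod 1 (l - 2) (by omega) (by omega) this) (fun h => by
        obtain ⟨j, hj, e⟩ := hs _ h
        have := hval.mp e.symm
        exact hnmod 0 (1 + j) (by omega) (by omega) (by rwa [zero_add]))
    omega
  · push Not at hold
    obtain ⟨i, hi⟩ := hold
    have new : ∀ {j}, ¬ G.Adj (f j) (f (j + 1)) →
        (G.Adj u (f j) ∨ G.Adj v (f j)) ∧ (f (j + 1) : V) = σ (f j) :=
      fun {j} h => (hadj j).resolve_left h
    have hex : ∃ j, 1 ≤ j ∧ ¬ G.Adj (f (i + j)) (f (i + j + 1)) := ⟨l, by omega, by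
      rwa [show (f (i + l) : V) = f i from hval.mpr (by simp [Nat.ModEq]),
        show (f (i + l + 1) : V) = f (i + 1) from hval.mpr (by
          rw [add_right_comm]; simp [Nat.ModEq])]⟩
    classical
    obtain ⟨hj1, hjn⟩ := Nat.find_spec hex
    have hmin : ∀ r, r < Nat.find hex → 1 ≤ r → G.Adj (f (i + r)) (f (i + r + 1)) :=
      fun r hr h1 => by
        by_contra h
        exact Nat.find_min hex hr ⟨h1, h⟩
    have hjl : Nat.find hex ≤ l := Nat.find_min' hex ⟨by omega, by
      rwa [show (f (i + l) : V) = f i from hval.mpr (by simp [Nat.ModEq]),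
        show (f (i + l + 1) : V) = f (i + 1) from hval.mpr (by
          rw [add_right_comm]; simp [Nat.ModEq])]⟩
    generalize Nat.find hex = j at hj1 hjn hmin hjl
    obtain ⟨w, hw, hs⟩ := exists_walk_of_adj_succ (fun i => (f i : V)) (i + 1) (j - 1)
      fun r hr => by
        have := hmin (1 + r) (by omega) (by omega)
        rwa [← add_assoc] at this
    have hwu : u ∉ w.support := fun h => by
      obtain ⟨r, -, e⟩ := hs _ h
      exact (f _).2.1 e.symm
    have hwv : v ∉ w.support := fun h => by
      obtain ⟨r, -, e⟩ := hs _ h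
      exact (f _).2.2 e.symm
    have hij : i + 1 + (j - 1) = i + j := by omega
    generalize hy : f (i + 1 + (j - 1)) = y at w hw hs hwu hwv
    rw [hij] at hy
    subst hy
    have hpair : (G.Adj u (f i) ∧ G.Adj u (f (i + 1)) ∨ G.Adj v (f i) ∧ G.Adj v (f (i + 1))) ∧
        σ (f (i + 1)) = f i := by
      obtain ⟨h | h, e⟩ := new hi
      · obtain ⟨-, h2, -, h4⟩ := hσ.1 _ (f i).2.2 h
        rw [e]
        exact ⟨Or.inl ⟨h, h2⟩, h4⟩
      · obtain ⟨-, h2, -, h4⟩ := hσ.2 _ (f i).2.1 h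
        rw [e]
        exact ⟨Or.inr ⟨h, h2⟩, h4⟩
    obtain ⟨hp, hσi⟩ := hpair
    -- If `j = l` there is a single new edge, whose ends share a deleted neighbour. Otherwise there
    -- are two, and the spare edge pays for a detour along `u v`.
    rcases hjl.eq_or_lt with hjl | hjl
    · have e : f (i + j) = f i := (hf _ _).mpr (by rw [hjl]; simp [Nat.ModEq])
      have hne : (f (i + 1) : V) ≠ f (i + j) := fun h => by
        rw [e] at h
        exact hnmod i 1 one_pos (by omega) (hval.mp h)
      rw [← e] at hp
      rcases hp with ⟨h1, h2⟩ | ⟨h1, h2⟩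
      · have := close w h2 h1 hne hwu
        omega
      · have := close w h2 h1 hne hwv
        omega
    · obtain ⟨hSj, ej⟩ := new hjn
      -- Two successive new edges would go to the partner and straight back.
      have hj2 : j ≠ 1 := by
        rintro rfl
        rw [hσi] at ej
        exact hnmod i 2 (by omega) (by omega) (hval.mp ej)
      have hne : (f (i + 1) : V) ≠ f (i + j) := fun h => by
        refine hnmod (i + 1) (j - 1) (by omega) (by omega) ?_
        rw [hij]
        exact (hval.mp h).symm
      have hS1 : G.Adj u (f (i + 1)) ∨ G.Adj v (f (i + 1)) := hp.imp And.right And.right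
      rcases hS1 with h1 | h1 <;> rcases hSj with h2 | h2
      · have := close w h1 h2 hne hwu
        omega
      · have := close (w.concat h2.symm) h1 huv (f (i + 1)).2.2 (by
          rw [Walk.support_concat]
          simpa using ⟨hwu, huv.ne⟩)
        rw [Walk.length_concat] at this
        omega
      · have := close (w.concat h2.symm) h1 huv.symm (f (i + 1)).2.1 (by
          rw [Walk.support_concat]
          simpa using ⟨hwv, huv.ne'⟩)
        rw [Walk.length_concat] at this
        omega
      · have := close w h1 h2 hne hwv
        omega

/-- If there is a `d`-regular graph of girth at least `g`, with `d` odd, then there is one of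
girth exactly `g` that is no larger. -/
theorem exists_regular_egirth_eq {d g : ℕ} (hd : Odd d) (hd3 : 3 ≤ d) (hg3 : 3 ≤ g)
    (n : ℕ) (V : Type) [Fintype V] [Nonempty V] (G : SimpleGraph V) (hn : Fintype.card V = n)
    (hreg : ∀ x, (G.neighborSet x).ncard = d) (hg : (g : ℕ∞) ≤ G.egirth) :
    ∃ m ≤ n, ∃ H : SimpleGraph (Fin m), (∀ x, (H.neighborSet x).ncard = d) ∧ H.egirth = g := by
  classical
  induction n using Nat.strong_induction_on generalizing V with
  | _ n ih =>
  rcases hg.eq_or_lt with he | hlt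
  · let e : V ≃ Fin n := Fintype.equivFinOfCardEq hn
    let i : G ≃g G.map e.toEmbedding := Iso.map e G
    refine ⟨n, le_rfl, G.map e.toEmbedding, fun x => ?_, ?_⟩
    · rw [← hreg (i.symm x), ← Nat.card_coe_set_eq, ← Nat.card_coe_set_eq]
      exact Nat.card_congr (i.symm.mapNeighborSet x)
    · rw [he, i.egirth_eq]
  · have hg' : ((g + 1 : ℕ) : ℕ∞) ≤ G.egirth := by
      rw [Nat.cast_add, Nat.cast_one]
      exact Order.add_one_le_of_lt hlt
    have hg4 : 4 ≤ G.egirth := le_trans (by exact_mod_cast Nat.succ_le_succ hg3) hg'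
    obtain ⟨u⟩ := ‹Nonempty V›
    obtain ⟨v, hv, z, hz, hvz⟩ := Set.one_lt_ncard_iff_nontrivial.mp
      (show 1 < (G.neighborSet u).ncard by rw [hreg]; omega)
    obtain ⟨σ, hσ⟩ := exists_isPairing hd hreg hg4 hv
    have hlt : Fintype.card {x : V // x ≠ u ∧ x ≠ v} < n := by
      rw [← hn]
      exact Fintype.card_subtype_lt (x := u) (by simp)
    -- Nonemptiness persists, so the descent on the order can only end at girth exactly `g`.
    have : Nonempty {x : V // x ≠ u ∧ x ≠ v} := ⟨⟨z, G.ne_of_adj hz.symm, hvz.symm⟩⟩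
    obtain ⟨m, hm, H, hH⟩ := ih _ hlt _ (G.deletePair hσ) rfl
      (fun x => (ncard_neighborSet_deletePair hσ hg4 hv x).trans (hreg _))
      (le_egirth_deletePair hσ hg' hv)
    exact ⟨m, hm.trans hlt.le, H, hH⟩

end Surgery

end SimpleGraph

/-! ### Coset graphs: girth from alternating words -/

section CosetGraph

open SimpleGraph

variable {Γ : Type*} [Group Γ]

/-- The incidence graph of the left cosets of `A` and of `B`, joined when they intersect. -/
def cosetGraph (A B : Subgroup Γ) : SimpleGraph ((Γ ⧸ A) ⊕ (Γ ⧸ B)) where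
  Adj x y := ∃ g : Γ, (x = .inl ↑g ∧ y = .inr ↑g) ∨ (x = .inr ↑g ∧ y = .inl ↑g)
  symm := ⟨fun _ _ ⟨g, h⟩ => ⟨g, h.symm.imp And.symm And.symm⟩⟩
  loopless := ⟨fun x ⟨g, h⟩ => by
    rcases h with ⟨h1, h2⟩ | ⟨h1, h2⟩
    · exact Sum.inl_ne_inr (h1.symm.trans h2)
    · exact Sum.inr_ne_inl (h1.symm.trans h2)⟩

variable {A B : Subgroup Γ}

theorem injOn_mk_mul_of_disjoint (h : A ⊓ B = ⊥) (g : Γ) :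
    Set.InjOn (fun a => ((g * a : Γ) : Γ ⧸ B)) (A : Set Γ) := by
  intro a ha a' ha' e
  rw [QuotientGroup.eq] at e
  have h1 : a⁻¹ * a' ∈ A ⊓ B := ⟨A.mul_mem (A.inv_mem ha) ha', by simpa [mul_assoc] using e⟩
  rw [h, Subgroup.mem_bot] at h1
  exact inv_mul_eq_one.mp h1

theorem ncard_neighborSet_cosetGraph (h : A ⊓ B = ⊥) {q : ℕ} (hA : Nat.card A = q)
    (hB : Nat.card B = q) (x : (Γ ⧸ A) ⊕ (Γ ⧸ B)) :
    ((cosetGraph A B).neighborSet x).ncard = q := by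
  rcases x with x | x
  · induction x using QuotientGroup.induction_on with
    | H g =>
    have : (cosetGraph A B).neighborSet (.inl ↑g) =
        Sum.inr '' ((fun a => ((g * a : Γ) : Γ ⧸ B)) '' (A : Set Γ)) := by
      ext y
      constructor
      · rintro ⟨g', ⟨h1, rfl⟩ | ⟨h1, -⟩⟩
        · rw [Sum.inl.injEq, QuotientGroup.eq] at h1
          exact ⟨_, ⟨_, h1, rfl⟩, by simp⟩
        · exact absurd h1 Sum.inl_ne_inr
      · rintro ⟨_, ⟨a, ha, rfl⟩, rfl⟩
        refine ⟨g * a, Or.inl ⟨?_, rfl⟩⟩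
        rw [Sum.inl.injEq, QuotientGroup.eq]
        simpa using ha
    rw [this, Set.ncard_image_of_injective _ Sum.inr_injective,
      (injOn_mk_mul_of_disjoint h g).ncard_image, ← Nat.card_coe_set_eq]
    exact hA
  · induction x using QuotientGroup.induction_on with
    | H g =>
    have : (cosetGraph A B).neighborSet (.inr ↑g) =
        Sum.inl '' ((fun a => ((g * a : Γ) : Γ ⧸ A)) '' (B : Set Γ)) := by
      ext y
      constructor
      · rintro ⟨g', ⟨h1, -⟩ | ⟨h1, rfl⟩⟩
        · exact absurd h1 Sum.inr_ne_inl
        · rw [Sum.inr.injEq, QuotientGroup.eq] at h1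
          exact ⟨_, ⟨_, h1, rfl⟩, by simp⟩
      · rintro ⟨_, ⟨a, ha, rfl⟩, rfl⟩
        refine ⟨g * a, Or.inr ⟨?_, rfl⟩⟩
        rw [Sum.inr.injEq, QuotientGroup.eq]
        simpa using ha
    rw [this, Set.ncard_image_of_injective _ Sum.inl_injective,
      (injOn_mk_mul_of_disjoint (inf_comm A B ▸ h) g).ncard_image, ← Nat.card_coe_set_eq]
    exact hB

/-- If no nontrivial alternating word of length less than `2 * N` in `A` and `B` is trivial, then
the coset graph has girth at least `2 * N`. -/
theorem le_egirth_cosetGraph (h : A ⊓ B = ⊥) {N : ℕ}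
    (hword : ∀ j, 0 < j → ∀ e : ℕ → Γ,
      (∀ i, ∃ b ∈ B, b ≠ 1 ∧ ∃ a ∈ A, a ≠ 1 ∧ e (i + 1) = e i * (b * a)) → e j = e 0 → N ≤ j) :
    ((2 * N : ℕ) : ℕ∞) ≤ (cosetGraph A B).egirth := by
  rw [le_egirth]
  intro v c hc
  have h3 := hc.three_le_length
  obtain ⟨f, hadj, hf⟩ := hc.exists_periodic
  rw [Nat.cast_le]
  generalize c.length = l at h3 hf
  wlog h0 : ∃ y, f 0 = .inl y generalizing f
  · refine this (fun i => f (i + 1)) (fun i => hadj _)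
      (fun i j => (hf _ _).trans ⟨fun h => Nat.ModEq.add_right_cancel' 1 h,
        fun h => h.add_right 1⟩) ?_
    obtain ⟨g, ⟨h1, -⟩ | ⟨-, h1⟩⟩ := hadj 0
    · exact absurd ⟨_, h1⟩ h0
    · exact ⟨_, h1⟩
  choose x hx using hadj
  have hstep : ∀ i, (∃ y, f (2 * i) = .inl y) → f (2 * i) = .inl ↑(x (2 * i)) ∧
      f (2 * i + 1) = .inr ↑(x (2 * i)) ∧ f (2 * i + 1) = .inr ↑(x (2 * i + 1)) ∧
      f (2 * i + 2) = .inl ↑(x (2 * i + 1)) := by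
    rintro i ⟨y, hy⟩
    rcases hx (2 * i) with ⟨h1, h2⟩ | ⟨h1, h2⟩
    · rcases hx (2 * i + 1) with ⟨h4, h5⟩ | ⟨h4, h5⟩
      · exact absurd (h2.symm.trans h4) Sum.inr_ne_inl
      · exact ⟨h1, h2, h4, h5⟩
    · exact absurd (hy.symm.trans h1) Sum.inl_ne_inr
  have heven : ∀ i, ∃ y, f (2 * i) = .inl y := by
    intro i
    induction i with
    | zero => exact h0
    | succ i ih => exact ⟨_, (hstep i ih).2.2.2⟩
  have hE := fun i => hstep i (heven i)
  have hl0 : f l = f 0 := (hf _ _).mpr (by simp [Nat.ModEq])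
  have hl1 : f (l + 1) = f 1 := (hf _ _).mpr (by simp [Nat.ModEq])
  -- Absence of backtracking is what makes every factor of the word nontrivial.
  have hne : ∀ i, f (i + 2) ≠ f i := fun i e => by
    have h1 := Nat.ModEq.add_left_cancel' (c := i) (a := 2) (b := 0) ((hf _ _).mp e)
    rw [Nat.ModEq, Nat.zero_mod, Nat.mod_eq_of_lt (by omega)] at h1
    omega
  obtain ⟨j, rfl | rfl⟩ := Nat.even_or_odd' l
  · have := hword j (by omega) (fun i => x (2 * i)) (fun i => ?_) ?_
    · omega
    · obtain ⟨a1, a2, a3, a4⟩ := hE i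
      obtain ⟨b1, b2, -⟩ := hE (i + 1)
      refine ⟨(x (2 * i))⁻¹ * x (2 * i + 1), ?_, fun e => ?_,
        (x (2 * i + 1))⁻¹ * x (2 * (i + 1)), ?_, fun e => ?_, by group⟩
      · rw [← QuotientGroup.eq]
        exact Sum.inr_injective (a2.symm.trans a3)
      · rw [inv_mul_eq_one] at e
        exact hne (2 * i) (by rw [a1, a4, e])
      · rw [← QuotientGroup.eq]
        exact Sum.inl_injective (a4.symm.trans b1)
      · rw [inv_mul_eq_one] at e
        refine hne (2 * i + 1) ?_
        rw [a3, e, ← b2]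
        rfl
    · obtain ⟨a1, a2, -⟩ := hE 0
      obtain ⟨b1, b2, -⟩ := hE j
      -- The cycle closes only up to cosets; agreeing modulo both `A` and `B` gives equality in the
      -- group.
      have h1 : (x (2 * 0))⁻¹ * x (2 * j) ∈ A ⊓ B := by
        refine ⟨?_, ?_⟩
        · exact QuotientGroup.eq.mp (Sum.inl_injective (a1.symm.trans (hl0.symm.trans b1)))
        · exact QuotientGroup.eq.mp (Sum.inr_injective (a2.symm.trans (hl1.symm.trans b2)))
      rw [h, Subgroup.mem_bot, inv_mul_eq_one] at h1
      exact h1.symm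
  · obtain ⟨y, hy⟩ := h0
    exact absurd (hy.symm.trans (hl0.symm.trans (hE j).2.1)) Sum.inl_ne_inr

theorem card_cosetGraph_le [Finite Γ] {q n : ℕ} (hq : 0 < q) (hA : Nat.card A = q)
    (hB : Nat.card B = q) (hn : Nat.card Γ ≤ n * q) :
    Nat.card ((Γ ⧸ A) ⊕ (Γ ⧸ B)) ≤ 2 * n := by
  have h1 := A.card_eq_card_quotient_mul_card_subgroup
  have h2 := B.card_eq_card_quotient_mul_card_subgroup
  rw [Nat.card_sum]
  have h3 : Nat.card (Γ ⧸ A) ≤ n := Nat.le_of_mul_le_mul_right (by rw [← hA] at hn ⊢; omega) hq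
  have h4 : Nat.card (Γ ⧸ B) ≤ n := Nat.le_of_mul_le_mul_right (by rw [← hB] at hn ⊢; omega) hq
  omega

end CosetGraph

/-! ### A matrix group over truncated polynomials without short alternating relations -/

section UnipotentModX

open Polynomial
open scoped MatrixGroups

variable (F : Type) [Field F] (d : ℕ)

/-- The ring `F[X] / (X ^ d)` of truncated polynomials. -/
abbrev TruncPoly : Type := AdjoinRoot (X ^ d : F[X])

variable [NeZero d]

namespace TruncPoly

/-- Evaluation of truncated polynomials at `0`. -/
noncomputable def constCoeff : TruncPoly F d →+* F :=
  AdjoinRoot.lift (RingHom.id F) 0 (by simp [NeZero.ne d])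

variable {F d}

@[simp]
theorem constCoeff_mk (p : F[X]) : constCoeff F d (AdjoinRoot.mk _ p) = p.eval 0 := by
  rw [constCoeff, AdjoinRoot.lift_mk, eval₂_id]

@[simp]
theorem constCoeff_of (a : F) : constCoeff F d (AdjoinRoot.of _ a) = a :=
  AdjoinRoot.lift_of _

@[simp]
theorem constCoeff_root : constCoeff F d (AdjoinRoot.root _) = 0 :=
  AdjoinRoot.lift_root _

theorem constCoeff_surjective : Function.Surjective (constCoeff F d) :=
  fun a => ⟨AdjoinRoot.of _ a, constCoeff_of a⟩

theorem isUnit_of_constCoeff_eq_one {x : TruncPoly F d} (hx : constCoeff F d x = 1) :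
    IsUnit x := by
  obtain ⟨p, rfl⟩ := AdjoinRoot.mk_surjective x
  have h1 : X ∣ p - 1 := by
    rw [X_dvd_iff, coeff_zero_eq_eval_zero]
    simpa [sub_eq_zero] using hx
  have h2 : IsNilpotent (AdjoinRoot.mk (X ^ d : F[X]) (p - 1)) :=
    ⟨d, by
      rw [← map_pow, AdjoinRoot.mk_eq_zero]
      exact pow_dvd_pow_of_dvd h1 d⟩
  have := h2.isUnit_one_add
  rwa [← map_one (AdjoinRoot.mk (X ^ d : F[X])), ← map_add, add_sub_cancel] at this

instance [Finite F] : Finite (TruncPoly F d) :=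
  have := (monic_X_pow (R := F) d).finite_adjoinRoot
  Module.finite_of_finite F

omit [NeZero d] in
theorem natCard [Finite F] : Nat.card (TruncPoly F d) = Nat.card F ^ d := by
  have := (monic_X_pow (R := F) d).finite_adjoinRoot
  have := (monic_X_pow (R := F) d).free_adjoinRoot
  rw [Module.natCard_eq_pow_finrank (K := F), (AdjoinRoot.powerBasis'
    (monic_X_pow (R := F) d)).finrank, AdjoinRoot.powerBasis'_dim, natDegree_X_pow]

theorem natCard_ker_mul [Finite F] :
    Nat.card (RingHom.ker (constCoeff F d)) * Nat.card F = Nat.card F ^ d := by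
  rw [← natCard (F := F) (d := d),
    ← Nat.card_congr (RingHom.quotientKerEquivOfSurjective
      (constCoeff_surjective (F := F) (d := d))).toEquiv, mul_comm]
  exact (AddSubgroup.card_eq_card_quotient_mul_card_addSubgroup
    (RingHom.ker (constCoeff F d)).toAddSubgroup).symm

end TruncPoly

open TruncPoly

/-- The matrices of determinant one over `F[X] / (X ^ d)` that are upper unitriangular modulo
`X`. -/
def unipotentModX : Subgroup SL(2, TruncPoly F d) where
  carrier := {M | constCoeff F d (M 1 0) = 0 ∧ constCoeff F d (M 0 0) = 1 ∧
    constCoeff F d (M 1 1) = 1}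
  one_mem' := by simp
  mul_mem' := by
    rintro M N ⟨h1, h2, h3⟩ ⟨h4, h5, h6⟩
    simp [Matrix.mul_apply, Fin.sum_univ_two, h1, h2, h3, h4, h5, h6]
  inv_mem' := by
    rintro M ⟨h1, h2, h3⟩
    rw [Matrix.SpecialLinearGroup.SL2_inv_expl]
    refine ⟨?_, ?_, ?_⟩ <;> simp [h1, h2, h3]

instance [Finite F] : Finite (unipotentModX F d) := by
  have : Finite (Matrix (Fin 2) (Fin 2) (TruncPoly F d)) := Pi.finite
  have : Finite SL(2, TruncPoly F d) := Subtype.finite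
  exact Subtype.finite

/-- The entry `M 0 0` is a unit, so the determinant fixes `M 1 1`; two of the other three entries
have prescribed constant term. Working in all of SL₂ would cost a further factor q^2 - 1, too much
for the final bound. -/
theorem natCard_unipotentModX_mul_le [Finite F] :
    Nat.card (unipotentModX F d) * Nat.card F ^ 2 ≤ Nat.card F ^ (3 * d) := by
  let K := RingHom.ker (constCoeff F d)
  let φ : unipotentModX F d → TruncPoly F d × K × K := fun M =>
    (M.1 0 1, ⟨M.1 1 0, M.2.1⟩, ⟨M.1 0 0 - 1, by
      rw [RingHom.mem_ker, map_sub, M.2.2.1, map_one, sub_self]⟩)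
  have hφ : Function.Injective φ := by
    rintro ⟨M, hM⟩ ⟨N, hN⟩ h
    simp only [φ, Prod.mk.injEq, Subtype.mk.injEq, sub_left_inj] at h
    obtain ⟨h01, h10, h00⟩ := h
    replace h10 : M 1 0 = N 1 0 := congrArg Subtype.val h10
    have hdM := M.det_coe
    have hdN := N.det_coe
    rw [Matrix.det_fin_two] at hdM hdN
    have h11 : M 1 1 = N 1 1 := by
      refine (isUnit_of_constCoeff_eq_one hM.2.1).mul_left_cancel ?_
      rw [← h01, ← h10, ← h00] at hdN
      linear_combination hdM - hdN
    rw [Subtype.mk.injEq]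
    ext i j
    fin_cases i <;> fin_cases j <;> assumption
  have h1 := Nat.card_le_card_of_injective φ hφ
  rw [Nat.card_prod, Nat.card_prod, natCard] at h1
  calc Nat.card (unipotentModX F d) * Nat.card F ^ 2
      ≤ Nat.card F ^ d * (Nat.card K * Nat.card K) * Nat.card F ^ 2 := Nat.mul_le_mul_right _ h1
    _ = Nat.card F ^ d * (Nat.card K * Nat.card F) * (Nat.card K * Nat.card F) := by ring
    _ = Nat.card F ^ (3 * d) := by
      rw [natCard_ker_mul]
      ring

variable {F}

/-- The upper unitriangular matrix with the constant `a` in the corner. -/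
noncomputable def upperElem (a : F) : unipotentModX F d :=
  ⟨⟨!![1, AdjoinRoot.mk _ (C a); 0, 1], by simp⟩, by
    refine ⟨?_, ?_, ?_⟩ <;> simp⟩

/-- The lower unitriangular matrix with `b * X` in the corner. -/
noncomputable def lowerElem (b : F) : unipotentModX F d :=
  ⟨⟨!![1, 0; AdjoinRoot.mk _ (C b * X), 1], by simp⟩, by
    refine ⟨?_, ?_, ?_⟩ <;> simp⟩

variable (F)

/-- The one-parameter group of the elements `upperElem`. -/
noncomputable def upperHom : Multiplicative F →* unipotentModX F d where
  toFun a := upperElem d a.toAdd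
  map_one' := by
    ext i j
    fin_cases i <;> fin_cases j <;> simp [upperElem]
  map_mul' a b := by
    refine Subtype.ext (Subtype.ext ?_)
    change !![_, _; _, _] = !![_, _; _, _] * !![_, _; _, _]
    simp [add_comm]

/-- The one-parameter group of the elements `lowerElem`. -/
noncomputable def lowerHom : Multiplicative F →* unipotentModX F d where
  toFun a := lowerElem d a.toAdd
  map_one' := by
    ext i j
    fin_cases i <;> fin_cases j <;> simp [lowerElem]
  map_mul' a b := by
    refine Subtype.ext (Subtype.ext ?_)
    change !![_, _; _, _] = !![_, _; _, _] * !![_, _; _, _]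
    simp [add_mul]

theorem upperHom_injective : Function.Injective (upperHom F d) := by
  intro a b h
  have h1 := congrArg (fun M : unipotentModX F d => constCoeff F d (M.1 0 1)) h
  simpa [upperHom, upperElem] using h1

theorem lowerHom_injective (hd : 2 ≤ d) : Function.Injective (lowerHom F d) := by
  intro a b h
  have h1 := congrArg (fun M : unipotentModX F d => M.1 1 0) h
  have h2 : AdjoinRoot.mk (X ^ d : F[X]) (C a.toAdd * X) = AdjoinRoot.mk _ (C b.toAdd * X) := h1
  rw [AdjoinRoot.mk_eq_mk, X_pow_dvd_iff] at h2
  have h3 := h2 1 (by omega)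
  rw [coeff_sub, coeff_C_mul_X, coeff_C_mul_X, if_pos rfl, if_pos rfl, sub_eq_zero] at h3
  exact h3

theorem lowerHom_range_inf_upperHom_range :
    (lowerHom F d).range ⊓ (upperHom F d).range = ⊥ := by
  rw [eq_bot_iff]
  rintro _ ⟨⟨b, rfl⟩, a, h⟩
  have h1 := congrArg (fun M : unipotentModX F d => constCoeff F d (M.1 0 1)) h
  have h2 : a.toAdd = 0 := by simpa [upperHom, lowerHom, upperElem, lowerElem] using h1
  have h3 : a = 1 := h2
  rw [Subgroup.mem_bot, ← h, h3, map_one]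

variable {F} in
/-- An alternating product of `n` pairs of nontrivial unipotents is the reduction modulo `X ^ d`
of a polynomial matrix of determinant one whose trace has degree exactly `n`. -/
theorem exists_polynomial_lift (e : ℕ → unipotentModX F d)
    (he : ∀ i, ∃ a b : F, a ≠ 0 ∧ b ≠ 0 ∧ e (i + 1) = e i * (upperElem d a * lowerElem d b))
    (n : ℕ) :
    ∃ α β γ δ : F[X], α * δ - β * γ = 1 ∧
      ((e 0)⁻¹ * e n).1.1 = !![AdjoinRoot.mk _ α, AdjoinRoot.mk _ β;
        AdjoinRoot.mk _ γ, AdjoinRoot.mk _ δ] ∧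
      (α.coeff n ≠ 0 ∧ ∀ i, n < i → α.coeff i = 0) ∧ (∀ i, n ≤ i → β.coeff i = 0) ∧
      (∀ i, n < i → γ.coeff i = 0) ∧ ∀ i, n ≤ i → 0 < i → δ.coeff i = 0 := by
  induction n with
  | zero =>
    -- At `n = 0` the entry `δ` is 1, which is why its degree bound exempts the constant
    -- coefficient.
    refine ⟨1, 0, 0, 1, by simp, ?_, ⟨by simp, fun i hi => ?_⟩, by simp, by simp,
      fun i _ hi => ?_⟩
    · rw [inv_mul_cancel]
      ext i j
      fin_cases i <;> fin_cases j <;> simp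
    · rw [coeff_one, if_neg (by omega)]
    · rw [coeff_one, if_neg (by omega)]
  | succ n ih =>
    obtain ⟨α, β, γ, δ, hdet, hmat, ⟨hα0, hα⟩, hβ, hγ, hδ⟩ := ih
    obtain ⟨a, b, ha, hb, hab⟩ := he n
    have hXC : ∀ (p : F[X]) (i : ℕ), (p * (C b * X)).coeff (i + 1) = p.coeff i * b := fun p i => by
      rw [← mul_assoc, coeff_mul_X, coeff_mul_C]
    refine ⟨α + (α * C a + β) * (C b * X), α * C a + β, γ + (γ * C a + δ) * (C b * X),
      γ * C a + δ, ?_, ?_, ⟨?_, ?_⟩, ?_, ?_, ?_⟩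
    · linear_combination hdet
    · have h1 : ((e 0)⁻¹ * e (n + 1)).1.1 =
          ((e 0)⁻¹ * e n).1.1 * ((upperElem d a).1.1 * (lowerElem d b).1.1) := by
        rw [hab, ← mul_assoc]
        rfl
      rw [h1, hmat]
      ext i j
      fin_cases i <;> fin_cases j <;>
        simp [upperElem, lowerElem, Matrix.mul_apply, Fin.sum_univ_two] <;> ring
    · rw [coeff_add, hXC, coeff_add, coeff_mul_C, hα _ (Nat.lt_succ_self n), hβ n le_rfl]
      simp [ha, hb, hα0]
    · rintro (_ | i) hi
      · omega
      · rw [coeff_add, hXC, coeff_add, coeff_mul_C, hα (i + 1) (by omega), hα i (by omega),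
          hβ i (by omega)]
        simp
    · intro i hi
      rw [coeff_add, coeff_mul_C, hα i (by omega), hβ i (by omega)]
      simp
    · rintro (_ | i) hi
      · omega
      · rw [coeff_add, hXC, coeff_add, coeff_mul_C, hγ (i + 1) (by omega), hγ i (by omega),
          hδ i (by omega) (by omega)]
        simp
    · intro i hi h0
      rw [coeff_add, coeff_mul_C, hγ i (by omega), hδ i (by omega) h0]
      simp

/-- A matrix I + X^d N of determinant 1 has trace 2 - X^(2d) det N, so a relation modulo X^d forces
the trace to be 2 modulo X^(2d). The lift has trace of degree exactly `j`. Using the trace instead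
of a single entry doubles the girth bound. -/
theorem two_mul_le_of_alternating_word (j : ℕ) (hj : 0 < j) (e : ℕ → unipotentModX F d)
    (he : ∀ i, ∃ a ∈ (upperHom F d).range, a ≠ 1 ∧ ∃ b ∈ (lowerHom F d).range, b ≠ 1 ∧
      e (i + 1) = e i * (a * b)) (hej : e j = e 0) : 2 * d ≤ j := by
  obtain ⟨α, β, γ, δ, hdet, hmat, ⟨hα, -⟩, -, -, hδ⟩ := exists_polynomial_lift d e (fun i => by
    obtain ⟨_, ⟨a, rfl⟩, ha, _, ⟨b, rfl⟩, hb, hab⟩ := he i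
    refine ⟨a.toAdd, b.toAdd, fun h => ha ?_, fun h => hb ?_, hab⟩
    · rw [show a = 1 from h, map_one]
    · rw [show b = 1 from h, map_one]) j
  rw [hej, inv_mul_cancel] at hmat
  have h00 := congrFun (congrFun hmat 0) 0
  have h01 := congrFun (congrFun hmat 0) 1
  have h10 := congrFun (congrFun hmat 1) 0
  have h11 := congrFun (congrFun hmat 1) 1
  simp only [OneMemClass.coe_one, Matrix.SpecialLinearGroup.coe_one, Matrix.of_apply,
    Matrix.cons_val', Matrix.cons_val_zero, Matrix.cons_val_one, Matrix.one_apply, if_true,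
    Fin.isValue, zero_ne_one, one_ne_zero, if_false, Matrix.cons_val_fin_one] at h00 h01 h10 h11
  rw [← map_one (AdjoinRoot.mk (X ^ d : F[X])), eq_comm, AdjoinRoot.mk_eq_mk] at h00 h11
  rw [eq_comm, AdjoinRoot.mk_eq_zero] at h01 h10
  obtain ⟨α', hα'⟩ := h00
  obtain ⟨δ', hδ'⟩ := h11
  obtain ⟨β', rfl⟩ := h01
  obtain ⟨γ', rfl⟩ := h10
  have htr : X ^ (2 * d) ∣ α + δ - 2 := by
    refine ⟨β' * γ' - α' * δ', ?_⟩
    rw [two_mul, pow_add]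
    linear_combination hdet - (δ - 1) * hα' - X ^ d * α' * hδ'
  rw [X_pow_dvd_iff] at htr
  by_contra! hlt
  have := htr j hlt
  rw [coeff_sub, coeff_add, hδ j le_rfl hj, ← map_ofNat C 2, coeff_C, if_neg (by omega)] at this
  exact hα (by simpa using this)

end UnipotentModX

/-- For every prime power `q`, the `q`-regular graphs on at most `2 * q ^ (3 * t)` vertices
include one of girth at least `4 * t + 4`. -/
theorem exists_regular_large_girth (F : Type) [Field F] [Finite F] {t : ℕ} (ht : 1 ≤ t) :
    ∃ (V : Type) (_ : Fintype V) (_ : Nonempty V) (G : SimpleGraph V),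
      Fintype.card V ≤ 2 * Nat.card F ^ (3 * t) ∧
      (∀ x, (G.neighborSet x).ncard = Nat.card F) ∧ ((4 * t + 4 : ℕ) : ℕ∞) ≤ G.egirth := by
  classical
  let A := (lowerHom F (t + 1)).range
  let B := (upperHom F (t + 1)).range
  have hA : Nat.card A = Nat.card F := Nat.card_congr
    ((MonoidHom.ofInjective (lowerHom_injective F (t + 1) (by omega))).toEquiv.symm.trans
      Multiplicative.toAdd)
  have hB : Nat.card B = Nat.card F := Nat.card_congr
    ((MonoidHom.ofInjective (upperHom_injective F (t + 1))).toEquiv.symm.trans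
      Multiplicative.toAdd)
  have hAB : A ⊓ B = ⊥ := lowerHom_range_inf_upperHom_range F (t + 1)
  have hq : 0 < Nat.card F := Nat.card_pos
  have hcard : Nat.card (unipotentModX F (t + 1)) ≤ Nat.card F ^ (3 * t) * Nat.card F := by
    refine Nat.le_of_mul_le_mul_right ?_ (pow_pos hq 2)
    calc _ ≤ _ := natCard_unipotentModX_mul_le F (t + 1)
      _ = _ := by ring
  let inst : Fintype ((unipotentModX F (t + 1) ⧸ A) ⊕ (unipotentModX F (t + 1) ⧸ B)) :=
    Fintype.ofFinite _
  refine ⟨_, inst, ⟨.inl ((1 : unipotentModX F (t + 1)) : _ ⧸ A)⟩,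
    cosetGraph A B, ?_, ncard_neighborSet_cosetGraph hAB hA hB, ?_⟩
  · rw [← Nat.card_eq_fintype_card]
    exact card_cosetGraph_le hq hA hB hcard
  · have := le_egirth_cosetGraph hAB (N := 2 * (t + 1))
      (two_mul_le_of_alternating_word F (t + 1))
    convert this using 2
    ring

/-! ### Estimates for the number of cops -/

theorem sq_mul_sub_pow_lt {n s m : ℕ} (hn : 0 < n)
    (hm : 2 * n * Real.log n < s * m) : n ^ 2 * (n - s) ^ m < n ^ m := by
  have hn' : (0 : ℝ) < n := Nat.cast_pos.mpr hn
  -- This is 1 - x ≤ exp(-x); for `s ≥ n` the truncated difference is 0.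
  have h1 : ((n - s : ℕ) : ℝ) ≤ n * Real.exp (-(s / n)) := by
    rcases le_total s n with h | h
    · rw [Nat.cast_sub h]
      calc (n : ℝ) - s = n * (-(s / n) + 1) := by field_simp; ring
        _ ≤ _ := mul_le_mul_of_nonneg_left (Real.add_one_le_exp _) hn'.le
    · rw [Nat.sub_eq_zero_of_le h, Nat.cast_zero]
      positivity
  have h2 : (n : ℝ) ^ 2 = Real.exp (2 * Real.log n) := by
    rw [mul_comm, Real.exp_mul, Real.exp_log hn']
    norm_num
  have h3 : 2 * Real.log n + m * -(s / n) < 0 := by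
    have : 2 * Real.log n + m * -(s / n) = (2 * n * Real.log n - s * m) / n := by
      field_simp
      ring
    rw [this]
    exact div_neg_of_neg_of_pos (by linarith) hn'
  have h4 : (n : ℝ) ^ 2 * ((n - s : ℕ) : ℝ) ^ m < (n : ℝ) ^ m := by
    calc (n : ℝ) ^ 2 * ((n - s : ℕ) : ℝ) ^ m
        ≤ (n : ℝ) ^ 2 * (n * Real.exp (-(s / n))) ^ m := by gcongr
      _ = (n : ℝ) ^ m * Real.exp (2 * Real.log n + m * -(s / n)) := by
        rw [mul_pow, ← Real.exp_nat_mul, Real.exp_add, ← h2]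
        ring
      _ < (n : ℝ) ^ m * 1 := by
        gcongr
        rwa [Real.exp_lt_one_iff]
      _ = _ := mul_one _
  exact_mod_cast h4

theorem exists_forall_hitting_size_le {t : ℕ} (ht : 1 ≤ t) {ε : ℝ} (hε : 0 < ε) :
    ∃ Q : ℕ, ∀ q : ℕ, Q ≤ q → ∀ n : ℕ, 0 < n → n ≤ 2 * q ^ (3 * t) →
      ∃ m : ℕ, n ^ 2 * (n - (q - 1) ^ (t + 1)) ^ m < n ^ m ∧
        ((t + 1 : ℕ) : ℝ) * m ≤ ε * (q : ℝ) ^ (2 * t) := by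
  have hlim : Tendsto (fun q : ℕ => ((t + 1 : ℕ) : ℝ) *
      (2 ^ (t + 3) * (1 + 3 * t) * (Real.log q / q) + (q : ℝ)⁻¹)) atTop (𝓝 0) := by
    have h1 : Tendsto (fun q : ℕ => Real.log q / (q : ℝ)) atTop (𝓝 0) :=
      Real.isLittleO_log_id_atTop.tendsto_div_nhds_zero.comp tendsto_natCast_atTop_atTop
    have h2 : Tendsto (fun q : ℕ => (q : ℝ)⁻¹) atTop (𝓝 0) :=
      tendsto_inv_atTop_zero.comp tendsto_natCast_atTop_atTop
    simpa using ((h1.const_mul (2 ^ (t + 3) * (1 + 3 * (t : ℝ)))).add h2).const_mul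
      ((t + 1 : ℕ) : ℝ)
  obtain ⟨Q, hQ⟩ := eventually_atTop.mp (hlim.eventually (gt_mem_nhds hε))
  refine ⟨max Q 2, fun q hq n hn hnq => ?_⟩
  have hq2 : 2 ≤ q := (le_max_right _ _).trans hq
  have hqR : (2 : ℝ) ≤ q := by exact_mod_cast hq2
  have hq0 : (0 : ℝ) < q := by linarith
  have hlogq : 0 < Real.log q := Real.log_pos (by linarith)
  set s := (q - 1) ^ (t + 1) with hs
  -- Replacing q-1 by q/2 costs 2^(t+1), which with the two other factors 2 gives the constant
  -- 2^(t+3).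
  have hsR : ((q : ℝ) / 2) ^ (t + 1) ≤ s := by
    rw [hs, Nat.cast_pow, Nat.cast_sub (by omega), Nat.cast_one]
    gcongr
    linarith
  have hs0 : (0 : ℝ) < s := lt_of_lt_of_le (by positivity) hsR
  have hn1 : (1 : ℝ) ≤ n := by exact_mod_cast hn
  have hnR : (n : ℝ) ≤ 2 * (q : ℝ) ^ (3 * t) := by exact_mod_cast hnq
  have hlogn : Real.log n ≤ (1 + 3 * t) * Real.log q := by
    calc Real.log n ≤ Real.log ((q : ℝ) ^ (1 + 3 * t)) := by
          apply Real.log_le_log (by linarith)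
          rw [pow_add, pow_one]
          exact hnR.trans (by gcongr)
      _ = _ := by rw [Real.log_pow]; push_cast; ring
  have hlogn0 : 0 ≤ Real.log n := Real.log_nonneg hn1
  refine ⟨⌊2 * n * Real.log n / s⌋₊ + 1, sq_mul_sub_pow_lt hn ?_, ?_⟩
  · have := Nat.lt_floor_add_one (2 * n * Real.log n / s)
    rw [div_lt_iff₀ hs0] at this
    push_cast
    linarith
  · have h1 := Nat.floor_le (show 0 ≤ 2 * n * Real.log n / s by positivity)
    have h2 : 2 * n * Real.log n / s ≤
        2 ^ (t + 3) * (1 + 3 * t) * (Real.log q / q) * (q : ℝ) ^ (2 * t) := by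
      calc 2 * n * Real.log n / s
          ≤ 2 * (2 * (q : ℝ) ^ (3 * t)) * ((1 + 3 * t) * Real.log q) / ((q : ℝ) / 2) ^ (t + 1) := by
            gcongr
        _ = _ := by
          rw [div_pow, show 3 * t = 2 * t + t by ring, pow_add (q : ℝ) (2 * t), pow_succ (q : ℝ) t]
          field_simp
          ring
    -- Absorbs the rounding term +1.
    have h3 : (1 : ℝ) ≤ (q : ℝ)⁻¹ * (q : ℝ) ^ (2 * t) := by
      rw [← div_eq_inv_mul, one_le_div hq0]
      exact le_self_pow₀ (by linarith) (by omega)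
    calc ((t + 1 : ℕ) : ℝ) * ((⌊2 * n * Real.log n / s⌋₊ + 1 : ℕ) : ℝ)
        ≤ ((t + 1 : ℕ) : ℝ) * (2 ^ (t + 3) * (1 + 3 * t) * (Real.log q / q) * (q : ℝ) ^ (2 * t)
          + (q : ℝ)⁻¹ * (q : ℝ) ^ (2 * t)) := by
          gcongr
          push_cast
          linarith
      _ = ((t + 1 : ℕ) : ℝ) *
          (2 ^ (t + 3) * (1 + 3 * t) * (Real.log q / q) + (q : ℝ)⁻¹) * (q : ℝ) ^ (2 * t) := by ring
      _ ≤ ε * (q : ℝ) ^ (2 * t) := by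
        gcongr
        exact (hQ q ((le_max_left _ _).trans hq)).le

/-! ### The order of cages, and the conclusion -/

namespace SimpleGraph

theorem IsRegularOfDegree.ncard_neighborSet {V : Type*} [Fintype V] {G : SimpleGraph V}
    [DecidableRel G.Adj] {d : ℕ} (h : G.IsRegularOfDegree d) (x : V) :
    (G.neighborSet x).ncard = d := by
  rw [← h.degree_eq x, Set.ncard_eq_toFinset_card']
  rfl

/-- A cage of odd prime power degree `q` and girth `4 * t + 3` has at most `2 * q ^ (3 * t)`
vertices. -/
theorem IsCage.card_le_two_mul_pow {V : Type*} [Fintype V] {G : SimpleGraph V}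
    [DecidableRel G.Adj] {t p k : ℕ} (ht : 1 ≤ t) (hk : k ≠ 0) (hp : p.Prime) (hp2 : p ≠ 2)
    (hG : G.IsCage (p ^ k) (4 * t + 3)) : Fintype.card V ≤ 2 * (p ^ k) ^ (3 * t) := by
  classical
  have : Fact p.Prime := ⟨hp⟩
  obtain ⟨W, _, _, H, hcard, hreg, hgirth⟩ := exists_regular_large_girth (GaloisField p k) ht
  rw [GaloisField.card p k hk] at hcard
  have h3 : 3 ≤ p ^ k := by
    have := hp.two_le
    calc 3 ≤ p := by omega
      _ ≤ p ^ k := Nat.le_self_pow hk p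
  obtain ⟨m, hm, H', hreg', hgirth'⟩ := exists_regular_egirth_eq (d := p ^ k) (g := 4 * t + 3)
    ((hp.odd_of_ne_two hp2).pow) h3 (by omega) _ W H rfl
    (fun x => (hreg x).trans (GaloisField.card p k hk))
    (le_trans (by rw [Nat.cast_le]; omega) hgirth)
  refine (hG.card_le m H' (fun x => ?_) hgirth').trans (hm.trans hcard)
  rw [← hreg' x, Set.ncard_eq_toFinset_card']
  rfl

end SimpleGraph

theorem corollary3 (t : ℕ) (ht : 1 ≤ t) (η : ℕ → ℝ) (hη : Tendsto η atTop (𝓝 0))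
    (ε : ℝ) (hε : 0 < ε) :
    ∃ K : ℕ, ∀ k : ℕ, K ≤ k → ∀ p : ℕ, p.Prime → p ≠ 2 →
      ∀ (V : Type*) [Fintype V] (G : SimpleGraph V) [DecidableRel G.Adj],
        G.IsCage (p ^ k) (4 * t + 3) →
          (G.copNumber : ℝ) ≤ ε * (p : ℝ) ^ (2 * t * k) ∧
          (p : ℝ) ^ (2 * t * k) ≤ (G.minDegree : ℝ) ^ ((1 - η k) * ((G.girth : ℝ) / 2)) ∧
          (G.copNumber : ℝ) ≤ ε * (G.minDegree : ℝ) ^ ((1 - η k) * ((G.girth : ℝ) / 2)) := by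
  obtain ⟨Q, hQ⟩ := exists_forall_hitting_size_le ht hε
  obtain ⟨K, hK⟩ := eventually_atTop.mp
    -- The condition η < 3/(4t+3) gives (1-η)(4t+3)/2 > 2t.
    (hη.eventually (gt_mem_nhds (show (0 : ℝ) < 3 / (4 * t + 3) by positivity)))
  refine ⟨max (max Q K) 1, fun k hk p hp hp2 V _ G _ hG => ?_⟩
  simp only [max_le_iff] at hk
  obtain ⟨⟨hkQ, hkK⟩, hk1⟩ := hk
  have hreg := hG.regular.ncard_neighborSet
  have hV : Nonempty V := by
    by_contra h
    rw [not_nonempty_iff] at h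
    have h1 := hG.egirth_eq
    rw [SimpleGraph.egirth_eq_top.mpr fun a => h.elim a] at h1
    exact ENat.top_ne_natCast _ h1
  -- Uniformity in `p`: p^k > k for every prime, so a bound on `k` alone suffices.
  have hqQ : Q ≤ p ^ k := hkQ.trans (Nat.lt_pow_self hp.one_lt).le
  obtain ⟨m, hm, hmle⟩ := hQ (p ^ k) hqQ (Fintype.card V) Fintype.card_pos
    (hG.card_le_two_mul_pow ht (by omega) hp hp2)
  have hpow : ((p ^ k : ℕ) : ℝ) ^ (2 * t) = (p : ℝ) ^ (2 * t * k) := by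
    rw [Nat.cast_pow, ← pow_mul, mul_comm k]
  have hcop : (G.copNumber : ℝ) ≤ ε * (p : ℝ) ^ (2 * t * k) := by
    rw [← hpow]
    refine le_trans ?_ hmle
    exact_mod_cast SimpleGraph.copNumber_le hreg hG.egirth_eq.ge hm
  have hexp : (p : ℝ) ^ (2 * t * k) ≤
      (G.minDegree : ℝ) ^ ((1 - η k) * ((G.girth : ℝ) / 2)) := by
    have hdeg : G.minDegree = p ^ k := hG.regular.minDegree_eq
    have hgirth : G.girth = 4 * t + 3 := by
      rw [SimpleGraph.girth, hG.egirth_eq, ENat.toNat_natCast]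
    rw [hdeg, hgirth, ← hpow, ← Real.rpow_natCast]
    refine Real.rpow_le_rpow_of_exponent_le ?_ ?_
    · exact_mod_cast Nat.one_le_pow _ _ hp.pos
    · have h1 := hK k hkK
      rw [lt_div_iff₀ (by positivity)] at h1
      push_cast
      linarith
  exact ⟨hcop, hexp, hcop.trans (mul_le_mul_of_nonneg_left hexp hε.le)⟩
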